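/- An inglenook puzzle is given by positive integers $w,s,h,m_1,\dots,m_s$ with $w<h+m_1+\cdots+m_s$, a set $W$ of $w$ wagons, and sets $S$ (starting positions) and $F$ (finishing positions) of positions. Here a \emph{position} is a sequence $(W_0,W_1,\dots,W_s)$ of pairwise disjoint ordered subsets of $W$ with union $W$, such that $|W_0|\le h$ and $|W_i|\le m_i$ for $1\le i\le s$. ($W_0$ lists the wagons in the headshunt, from the shunting engine to the points; for $i\ge 1$, $W_i$ lists the wagons in Siding $i$, from the points to the buffer stop.) A \emph{move} takes a position $(W_0,\dots,W_s)$ to a different position $(W_0',\dots,W_s')$ such that for some $r\in\{1,\dots,s\}$ we have $W_i=W_i'$ for all $i\in\{1,\dots,s\}\setminus\{r\}$, and the concatenation of $W_0$ and $W_r$ equals the concatenation of $W_0'$ and $W_r'$. A starting position is \emph{solved} in $n$ moves when a sequence of $n$ moves takes it to some position in $F$, and the puzzle \emph{can always be solved} if every position in $S$ can be taken to a position in $F$ by a finite sequence of moves. The puzzle is \emph{natural} if $S$ is closed under permuting the wagons amongst themselves and, for some $z\in\{1,\dots,s\}$ and some wagon $\omega\in W$, all positions in $F$ have $\omega$ as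 the last wagon (nearest the buffer stop) in Siding $z$. Theorem. Let $w\ge 1$ be an integer. (i) If a natural inglenook puzzle with $w$ wagons can always be solved, then each of its starting positions can be solved in at most $2w^2+12w-10$ moves. (ii) There are a natural inglenook puzzle with $w$ wagons that can always be solved and a starting position of this puzzle such that every sequence of moves solving it from this position has at least $(w^2-1)/2$ moves. -/

import Mathlib

namespace Inglenook

/-- A position of an inglenook puzzle with wagon set `W`, headshunt length `h` and `s` sidings of
lengths `m 0, …, m (s - 1)`. Track `0` is the headshunt, its wagons listed from the shunting engine
to the points; track `i.succ` is the siding of length `m i`, its wagons listed from the points to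
the buffer stop. Ordered subsets of `W` are lists without repetitions. -/
@[ext]
structure Position (W : Type*) {s : ℕ} (h : ℕ) (m : Fin s → ℕ) where
  track : Fin (s + 1) → List W
  nodup : ∀ i, (track i).Nodup
  cover : ∀ a : W, ∃ i, a ∈ track i
  disjoint : ∀ i j, i ≠ j → List.Disjoint (track i) (track j)
  siding_le : ∀ i : Fin s, (track i.succ).length ≤ m i
  headshunt_le : (track 0).length ≤ h

variable {W : Type*} {s h : ℕ} {m : Fin s → ℕ}

/-- The position obtained by permuting the wagons amongst themselves. -/
def Position.permute (σ : Equiv.Perm W) (p : Position W h m) : Position W h m where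
  track i := (p.track i).map σ
  nodup i := (p.nodup i).map σ.injective
  cover a := by
    obtain ⟨i, hi⟩ := p.cover (σ.symm a)
    exact ⟨i, List.mem_map.2 ⟨_, hi, σ.apply_symm_apply a⟩⟩
  disjoint i j hij := List.disjoint_map σ.injective (p.disjoint i j hij)
  siding_le i := by simpa using p.siding_le i
  headshunt_le := by simpa using p.headshunt_le

/-- A move: the two positions are distinct, and for some siding `r` all other sidings agree and
the concatenation of the headshunt with siding `r` is the same in both positions. -/
def IsMove (p q : Position W h m) : Prop :=
  p ≠ q ∧ ∃ r : Fin s, (∀ i : Fin s, i ≠ r → p.track i.succ = q.track i.succ) ∧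
    p.track 0 ++ p.track r.succ = q.track 0 ++ q.track r.succ

/-- The inglenook graph: vertices are the positions, edges are the moves. -/
def graph (W : Type*) {s : ℕ} (h : ℕ) (m : Fin s → ℕ) : SimpleGraph (Position W h m) where
  Adj := IsMove
  symm := ⟨fun _ _ ⟨hne, r, h₁, h₂⟩ => ⟨hne.symm, r, fun i hi => (h₁ i hi).symm, h₂.symm⟩⟩
  loopless := ⟨fun _ hp => hp.1 rfl⟩

/-- An inglenook puzzle with wagon set `W`: `s` sidings of lengths `m i`, a headshunt of length
`h`, a set `S` of starting positions and a set `F` of finishing positions. -/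
structure Puzzle (W : Type*) [Fintype W] where
  s : ℕ
  h : ℕ
  m : Fin s → ℕ
  wagons_pos : 0 < Fintype.card W
  s_pos : 0 < s
  h_pos : 0 < h
  m_pos : ∀ i, 0 < m i
  wagons_lt : Fintype.card W < h + ∑ i, m i
  S : Set (Position W h m)
  F : Set (Position W h m)

namespace Puzzle

variable [Fintype W]

/-- The graph on which the puzzle is played. -/
def graph (P : Puzzle W) : SimpleGraph (Position W P.h P.m) :=
  Inglenook.graph W P.h P.m

/-- `S` is closed under permuting the wagons, and for some siding `z` and some wagon `ω`, every
finishing position has `ω` as the last wagon (nearest the buffer stop) of siding `z`. -/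
def IsNatural (P : Puzzle W) : Prop :=
  (∀ p ∈ P.S, ∀ σ : Equiv.Perm W, p.permute σ ∈ P.S) ∧
    ∃ (z : Fin P.s) (ω : W), ∀ q ∈ P.F, (q.track z.succ).getLast? = some ω

/-- Every starting position has a finishing position in its connected component. -/
def AlwaysSolvable (P : Puzzle W) : Prop :=
  ∀ p ∈ P.S, ∃ q ∈ P.F, P.graph.Reachable p q

end Puzzle

end Inglenook

/-!
For the upper bound, empty the headshunt in both the starting and the finishing position, in at most
`w` moves each, and connect the resulting positions by induction on the number `k` of wagons: some
target wagon can be brought to its buffer stop in at most `4k + 8` moves and then be left there for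
good, shortening its siding by one. The induction is supported by three conditions: the sidings have
room for all wagons, the headshunt and any `s - 1` sidings have room for more than `k` wagons, and
there are at least three sidings, or two if the headshunt is longer than one. They pass to `k - 1`
wagons and the shortened siding for a suitable choice of the siding. A natural puzzle that can
always be solved satisfies them, since otherwise every move preserves the last wagon of some list of
wagons read off from the position; permuting the wagons of a starting position makes that wagon
arbitrary, whereas the finishing positions prescribe the wagon at one buffer stop.

For the lower bound, let the headshunt have length two. With two sidings the wagons form a line in
which the wagons in the headshunt may be read in either direction. The total number of inversions of
the two readings changes by at most one in a move, whereas reversing the order of `w` wagons changes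
it by `w² - w`.
-/

namespace Inglenook

open Function Finset

section Yard

/-- The tracks of a puzzle with the wagons standing on them, listed as in `Position`. Wagons may be
missing or repeated and no lengths are imposed, so that a wagon which has reached its final place at
a buffer stop can be left out of consideration. -/
structure Yard (α ι : Type*) where
  headshunt : List α
  siding : ι → List α

variable {α ι : Type*} {h : ℕ} {c : ι → ℕ} {n n' : ℕ} {x y z : Yard α ι}

/-- The yard respects the lengths `h` of the headshunt and `c i` of the sidings. -/
structure Yard.Fits (h : ℕ) (c : ι → ℕ) (x : Yard α ι) : Prop where
  headshunt_le : x.headshunt.length ≤ h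
  siding_le : ∀ i, (x.siding i).length ≤ c i

/-- The wagons of a yard, with multiplicity. -/
def Yard.contents [Fintype ι] (x : Yard α ι) : Multiset α :=
  x.headshunt + ∑ i, (x.siding i : Multiset α)

/-- The yard obtained from `x` by lengthening each siding `i` at the buffer stop by the wagons
`B i`. -/
def Yard.extend (x : Yard α ι) (B : ι → List α) : Yard α ι :=
  ⟨x.headshunt, fun i => x.siding i ++ B i⟩

theorem Yard.card_contents [Fintype ι] (x : Yard α ι) :
    Multiset.card x.contents = x.headshunt.length + ∑ i, (x.siding i).length := by
  simp [contents]

variable [DecidableEq ι]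

theorem Yard.extend_update (H : List α) (T B : ι → List α) (r : ι) (A : List α) :
    (Yard.mk H (update T r A)).extend B = ⟨H, update (fun i => T i ++ B i) r (A ++ B r)⟩ :=
  congrArg (Yard.mk H) (funext fun i => by grind)

/-- A single shunt: the engine pulls a block of wagons out of a siding or pushes one into it. The
block may be empty. Only the length of the track receiving the block is checked. -/
inductive Shunt (h : ℕ) (c : ι → ℕ) : Yard α ι → Yard α ι → Prop
  | pull {A B : List α} {T : ι → List α} {r : ι} (H : List α) (hT : T r = A ++ B)
      (hA : H.length + A.length ≤ h) : Shunt h c ⟨H, T⟩ ⟨H ++ A, update T r B⟩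
  | push {A : List α} {T : ι → List α} {r : ι} (H : List α) (hA : A.length + (T r).length ≤ c r) :
      Shunt h c ⟨H ++ A, T⟩ ⟨H, update T r (A ++ T r)⟩

/-- `Within h c n x y`: at most `n` shunts lead from the yard `x` to the yard `y`. -/
inductive Within (h : ℕ) (c : ι → ℕ) : ℕ → Yard α ι → Yard α ι → Prop
  | refl (n : ℕ) (x : Yard α ι) : Within h c n x x
  | tail {n : ℕ} {x y z : Yard α ι} (hxy : Within h c n x y) (hyz : Shunt h c y z) :
      Within h c (n + 1) x z

theorem Shunt.fits (hxy : Shunt h c x y) (hx : x.Fits h c) : y.Fits h c := by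
  obtain ⟨hH, hT⟩ := hx
  cases hxy with
  | @pull A B T r H hr hA =>
    have hTr := hT r
    exact ⟨by grind, fun i => by have := hT i; grind⟩
  | push H hA => exact ⟨by grind, fun i => by have := hT i; grind⟩

theorem Shunt.exists_append_eq (hxy : Shunt h c x y) :
    ∃ r, (∀ i, i ≠ r → x.siding i = y.siding i) ∧
      x.headshunt ++ x.siding r = y.headshunt ++ y.siding r := by
  cases hxy with
  | @pull _ _ _ r => exact ⟨r, by grind, by grind⟩
  | @push _ _ r => exact ⟨r, by grind, by grind⟩

theorem Shunt.contents_eq [Fintype ι] (hxy : Shunt h c x y) : x.contents = y.contents := by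
  obtain ⟨r, hne, hr⟩ := hxy.exists_append_eq
  simp only [Yard.contents, Fintype.sum_eq_add_sum_compl r, ← add_assoc, Multiset.coe_add, hr]
  congr 1
  exact Finset.sum_congr rfl fun i hi => by rw [hne i (by simpa using hi)]

theorem Shunt.extend {c' : ι → ℕ} {B : ι → List α} (hc : ∀ i, c' i + (B i).length ≤ c i)
    (hxy : Shunt h c' x y) : Shunt h c (x.extend B) (y.extend B) := by
  cases hxy with
  | pull H hr hA =>
    rw [Yard.extend_update]
    exact .pull H (by simp [hr]) hA
  | push H hA =>
    rw [Yard.extend_update, List.append_assoc]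
    exact .push H (by grind)

theorem Shunt.within (hxy : Shunt h c x y) : Within h c 1 x y :=
  .tail (.refl 0 x) hxy

namespace Within

theorem mono (hxy : Within h c n x y) (hn : n ≤ n') : Within h c n' x y := by
  induction hxy generalizing n' with
  | refl => exact .refl _ _
  | tail _ hs ih =>
    obtain ⟨n', rfl⟩ := Nat.exists_eq_add_of_le' (Nat.one_le_of_lt hn)
    exact .tail (ih (by omega)) hs

theorem trans (hxy : Within h c n x y) (hyz : Within h c n' y z) : Within h c (n + n') x z := by
  induction hyz with
  | refl => exact hxy.mono (Nat.le_add_right _ _)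
  | tail _ hs ih => exact .tail (ih hxy) hs

theorem fits (hxy : Within h c n x y) (hx : x.Fits h c) : y.Fits h c := by
  induction hxy with
  | refl => exact hx
  | tail _ hs ih => exact hs.fits (ih hx)

theorem extend {c' : ι → ℕ} {B : ι → List α} (hc : ∀ i, c' i + (B i).length ≤ c i)
    (hxy : Within h c' n x y) : Within h c n (x.extend B) (y.extend B) := by
  induction hxy with
  | refl => exact .refl _ _
  | tail _ hs ih => exact .tail ih (hs.extend hc)

theorem contents_eq [Fintype ι] (hxy : Within h c n x y) : x.contents = y.contents := by
  induction hxy with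
  | refl => rfl
  | tail _ hs ih => exact ih.trans hs.contents_eq

theorem sum_length_eq [Fintype ι] (hxy : Within h c n x y) :
    x.headshunt.length + ∑ i, (x.siding i).length =
      y.headshunt.length + ∑ i, (y.siding i).length := by
  rw [← Yard.card_contents, ← Yard.card_contents, hxy.contents_eq]

theorem transfer {T : ι → List α} {i j : ι} {a : α} {B : List α} (H : List α) (hi : T i = a :: B)
    (hij : i ≠ j) (hj : (T j).length < c j) (hH : H.length < h) :
    Within h c 2 ⟨H, T⟩ ⟨H, update (update T i B) j (a :: T j)⟩ := by
  have hpull : Shunt h c ⟨H, T⟩ ⟨H ++ [a], update T i B⟩ := .pull H (by simpa using hi) hH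
  have hpush : Shunt h c ⟨H ++ [a], update T i B⟩ ⟨H, update (update T i B) j (a :: T j)⟩ := by
    have := Shunt.push (h := h) (c := c) (A := [a]) (T := update T i B) (r := j) H (by grind)
    rwa [update_of_ne hij.symm] at this
  exact hpull.within.tail hpush

theorem drain (D : Finset ι) {i : ι} (hi : i ∉ D) {H A B : List α} (hH : H.length < h)
    {T : ι → List α} (hT : T i = A ++ B)
    (hD : ∑ j ∈ D, (T j).length + A.length ≤ ∑ j ∈ D, c j) :
    ∃ T' : ι → List α, Within h c (2 * A.length) ⟨H, T⟩ ⟨H, T'⟩ ∧ T' i = B ∧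
      (∀ j ∉ D, j ≠ i → T' j = T j) ∧
      ∑ j ∈ D, (T' j).length = ∑ j ∈ D, (T j).length + A.length := by
  induction A generalizing T with
  | nil => exact ⟨T, .refl _ _, hT, fun _ _ _ => rfl, rfl⟩
  | cons a A ih =>
    rw [List.length_cons] at hD
    obtain ⟨j, hj, hlt⟩ : ∃ j ∈ D, (T j).length < c j := Finset.exists_lt_of_sum_lt (by omega)
    have hij : i ≠ j := fun hij => hi (hij ▸ hj)
    have htransfer := transfer (c := c) H hT hij hlt hH
    set T₁ := update (update T i (A ++ B)) j (a :: T j)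
    have hsum : ∑ l ∈ D, (T₁ l).length = ∑ l ∈ D, (T l).length + 1 := by
      rw [← Finset.add_sum_erase D _ hj, ← Finset.add_sum_erase D (fun l => (T l).length) hj,
        Finset.sum_congr rfl fun l (hl : l ∈ D.erase j) => show _ = (T l).length by grind]
      grind
    obtain ⟨T', hdrain, hTi, hne, hsum'⟩ := ih (T := T₁) (by grind) (by omega)
    exact ⟨T', (htransfer.trans hdrain).mono (by grind), hTi, by grind, by grind⟩

theorem clear_headshunt [Fintype ι] (H : List α) (T : ι → List α)
    (hc : H.length + ∑ i, (T i).length ≤ ∑ i, c i) :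
    ∃ T', Within h c H.length ⟨H, T⟩ ⟨[], T'⟩ := by
  induction H using List.reverseRecOn generalizing T with
  | nil => exact ⟨T, .refl _ _⟩
  | append_singleton H a ih =>
    rw [List.length_append, List.length_singleton] at hc ⊢
    obtain ⟨j, -, hj⟩ : ∃ j ∈ univ, (T j).length < c j := Finset.exists_lt_of_sum_lt (by omega)
    have hpush := Shunt.push (h := h) (c := c) (A := [a]) (T := T) (r := j) H (by grind)
    have hsum := hpush.within.sum_length_eq
    simp only [List.length_append, List.length_singleton] at hsum
    obtain ⟨T', hclear⟩ := ih (update T j ([a] ++ T j)) (by omega)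
    exact ⟨T', (hpush.within.trans hclear).mono (by omega)⟩

end Within

end Yard

section Place

variable {α ι : Type*} {h : ℕ} {c : ι → ℕ} {T : ι → List α} {x : α} {A B : List α} {r z : ι} {k : ℕ}

theorem exists_eq_append_of_le_length {l : List α} {n : ℕ} (hn : n ≤ l.length) :
    ∃ l₁ l₂, l = l₁ ++ l₂ ∧ l₁.length = n :=
  ⟨l.take n, l.drop n, (List.take_append_drop n l).symm, List.length_take_of_le hn⟩

theorem length_eq_of_sum_le {D : Finset ι} (hT : ∀ i, (T i).length ≤ c i)
    (hD : ∑ i ∈ D, c i ≤ ∑ i ∈ D, (T i).length) {i : ι} (hi : i ∈ D) : (T i).length = c i :=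
  (Finset.sum_eq_sum_iff_of_le fun i _ => hT i).1
    ((Finset.sum_le_sum fun i _ => hT i).antisymm hD) i hi

variable [DecidableEq ι]

namespace Within

theorem isolate_last {u : ι} (hur : u ≠ r) (hu : (T u).length < c u)
    (hr : A.length + (T r).length ≤ c r) (hh : 1 ≤ h) :
    ∃ T', Within h c 3 ⟨A ++ [x], T⟩ ⟨[x], T'⟩ := by
  set T₁ := update T u ([x] ++ T u)
  set T₂ := update T₁ r (A ++ T₁ r)
  have hpush_x : Shunt h c ⟨A ++ [x], T⟩ ⟨A, T₁⟩ := .push A (by grind)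
  have hpush_A : Shunt h c ⟨A, T₁⟩ ⟨[], T₂⟩ := .push [] (by grind)
  have hpull_x : Shunt h c ⟨[], T₂⟩ ⟨[x], update T₂ u (T u)⟩ :=
    .pull (A := [x]) [] (by grind) (by simpa)
  exact ⟨_, (hpush_x.within.tail hpush_A).tail hpull_x⟩

theorem isolate_of_full {u : ι} (hur : u ≠ r) (hu : (T u).length = c u) (hcu : 0 < c u)
    (hr : T r = A ++ x :: B) (hh : A.length + 2 ≤ h) (hcr : (T r).length ≤ c r) :
    ∃ T', Within h c 6 ⟨[], T⟩ ⟨[x], T'⟩ := by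
  obtain ⟨t, U, hU⟩ := List.exists_cons_of_length_pos (hu ▸ hcu)
  set T₁ := update T r B
  set T₂ := update T₁ u U
  set T₃ := update T₂ r ([t] ++ T₂ r)
  have hpull_x : Shunt h c ⟨[], T⟩ ⟨A ++ [x], T₁⟩ :=
    .pull (A := A ++ [x]) [] (by simpa using hr) (by grind)
  have hpull_t : Shunt h c ⟨A ++ [x], T₁⟩ ⟨A ++ [x] ++ [t], T₂⟩ :=
    .pull (A := [t]) (A ++ [x]) (by grind) (by grind)
  have hpush_t : Shunt h c ⟨A ++ [x] ++ [t], T₂⟩ ⟨A ++ [x], T₃⟩ := .push (A ++ [x]) (by grind)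
  obtain ⟨T', hisolate⟩ := isolate_last (h := h) (c := c) (x := x) (A := A) (r := r) (T := T₃) hur
    (by grind) (by grind) (by omega)
  exact ⟨T', ((hpull_x.within.tail hpull_t).tail hpush_t).trans hisolate⟩

theorem isolate_of_lt [Fintype ι] (hr : T r = A ++ x :: B) (hh : 1 ≤ h) (hcr : (T r).length ≤ c r)
    (hfree : ∑ i ∈ {r}ᶜ, (T i).length + (A.length + 1 - h) < ∑ i ∈ {r}ᶜ, c i) :
    ∃ T', Within h c (2 * A.length + 4) ⟨[], T⟩ ⟨[x], T'⟩ := by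
  obtain ⟨A₁, A₂, rfl, hA₁⟩ := exists_eq_append_of_le_length (l := A) (n := A.length + 1 - h)
    (by omega)
  rw [List.length_append] at hfree hA₁ ⊢
  obtain ⟨T₁, hdrain, hTr, -, hsum⟩ := drain (h := h) (c := c) (i := r) (A := A₁)
    (B := A₂ ++ x :: B) {r}ᶜ (by simp) (H := []) (by simpa) (by simpa using hr) (by omega)
  obtain ⟨u, hu, hlt⟩ : ∃ u ∈ ({r}ᶜ : Finset ι), (T₁ u).length < c u :=
    Finset.exists_lt_of_sum_lt (by omega)
  have hur : u ≠ r := by simpa using hu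
  have hpull : Shunt h c ⟨[], T₁⟩ ⟨A₂ ++ [x], update T₁ r B⟩ :=
    .pull (A := A₂ ++ [x]) [] (by simpa using hTr) (by grind)
  obtain ⟨T', hisolate⟩ := isolate_last (h := h) (c := c) (x := x) (A := A₂) (r := r)
    (T := update T₁ r B) hur (by grind) (by grind) hh
  exact ⟨T', ((hdrain.tail hpull).trans hisolate).mono (by omega)⟩

theorem isolate [Fintype ι] (hT : ∀ i, (T i).length ≤ c i) (hh : 2 ≤ h)
    (hne : ∃ u, u ≠ r ∧ 0 < c u) (hk : ∑ i, (T i).length = k) (hk2 : 2 ≤ k)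
    (hc : k + c r < h + ∑ i, c i) (hr : T r = A ++ x :: B) :
    ∃ T', Within h c (2 * k + 2) ⟨[], T⟩ ⟨[x], T'⟩ := by
  have hTr : (T r).length = A.length + B.length + 1 := by grind
  rw [Fintype.sum_eq_add_sum_compl r] at hk hc
  by_cases hfree : ∑ i ∈ {r}ᶜ, (T i).length < ∑ i ∈ {r}ᶜ, c i
  · obtain ⟨T', hisolate⟩ := isolate_of_lt (c := c) (h := h) hr (by omega) (hT r) (by omega)
    exact ⟨T', hisolate.mono (by omega)⟩
  · obtain ⟨u, hur, hcu⟩ := hne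
    have hfull := length_eq_of_sum_le hT (not_lt.1 hfree) (i := u) (by simpa using hur)
    obtain ⟨T', hisolate⟩ := isolate_of_full (h := h) hur hfull hcu hr (by omega) (hT r)
    exact ⟨T', hisolate.mono (by omega)⟩

theorem stow_of_lt [Fintype ι] (hh : 2 ≤ h)
    (hfree : ∑ i ∈ {z}ᶜ, (T i).length + ((T z).length + 1 - h) < ∑ i ∈ {z}ᶜ, c i) :
    ∃ T' u U, Within h c (2 * (T z).length + 1) ⟨[x], T⟩ ⟨[], T'⟩ ∧ u ≠ z ∧ T' u = x :: U ∧
      (T' z).length < h := by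
  obtain ⟨A₁, A₂, hA, hA₁⟩ := exists_eq_append_of_le_length (l := T z) (n := (T z).length + 1 - h)
    (by omega)
  obtain ⟨T₁, hdrain, hTz, -, hsum⟩ := drain (h := h) (c := c) {z}ᶜ (by simp) (H := [x])
    (by simpa) hA (by omega)
  obtain ⟨u, hu, hlt⟩ : ∃ u ∈ ({z}ᶜ : Finset ι), (T₁ u).length < c u :=
    Finset.exists_lt_of_sum_lt (by omega)
  have huz : u ≠ z := by simpa using hu
  have hpush : Shunt h c ⟨[x], T₁⟩ ⟨[], update T₁ u ([x] ++ T₁ u)⟩ := .push [] (by grind)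
  exact ⟨_, u, T₁ u, (hdrain.tail hpush).mono (by grind), huz, by grind, by grind⟩

theorem stow_of_full {u : ι} (huz : u ≠ z) (hu : (T u).length = c u) (hcu : 0 < c u)
    (hcz : (T z).length < c z) (hh : (T z).length + 1 < h) :
    ∃ T' U, Within h c 3 ⟨[x], T⟩ ⟨[], T'⟩ ∧ T' u = x :: U ∧ (T' z).length < h := by
  obtain ⟨t, U, hU⟩ := List.exists_cons_of_length_pos (hu ▸ hcu)
  have htransfer := transfer (h := h) (c := c) [x] hU huz hcz (by grind)
  set T₁ := update (update T u U) z (t :: T z)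
  have hpush : Shunt h c ⟨[x], T₁⟩ ⟨[], update T₁ u ([x] ++ T₁ u)⟩ := .push [] (by grind)
  exact ⟨_, U, htransfer.tail hpush, by grind, by grind⟩

theorem stow [Fintype ι] (hT : ∀ i, (T i).length ≤ c i) (hh : 2 ≤ h)
    (hne : ∃ u, u ≠ z ∧ 0 < c u) (hk : 1 + ∑ i, (T i).length = k) (hk2 : 2 ≤ k)
    (hkc : k ≤ ∑ i, c i) (hc : k + c z < h + ∑ i, c i) :
    ∃ T' u U, Within h c (2 * k - 1) ⟨[x], T⟩ ⟨[], T'⟩ ∧ u ≠ z ∧ T' u = x :: U ∧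
      (T' z).length < h := by
  rw [Fintype.sum_eq_add_sum_compl z] at hk hc hkc
  by_cases hfree : ∑ i ∈ {z}ᶜ, (T i).length + ((T z).length + 1 - h) < ∑ i ∈ {z}ᶜ, c i
  · obtain ⟨T', u, U, hstow, hu⟩ := stow_of_lt (x := x) hh hfree
    exact ⟨T', u, U, hstow.mono (by omega), hu⟩
  · obtain ⟨u, huz, hcu⟩ := hne
    have hfull := length_eq_of_sum_le hT (D := {z}ᶜ) (by omega) (i := u) (by simpa using huz)
    obtain ⟨T', U, hstow, hu, hz⟩ := stow_of_full (x := x) huz hfull hcu (h := h) (by omega)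
      (by omega)
    exact ⟨T', u, U, hstow.mono (by omega), huz, hu, hz⟩

theorem bury (hT : ∀ i, (T i).length ≤ c i) {u : ι} (huz : u ≠ z) {U : List α} (hu : T u = x :: U)
    (hz : (T z).length < h) (hcz : 0 < c z) :
    ∃ T' B, Within h c 5 ⟨[], T⟩ ⟨[], T'⟩ ∧ T' z = B ++ [x] := by
  set T₁ := update (update T z []) u U
  set T₂ := update T₁ z ([x] ++ T₁ z)
  have hpull_z : Shunt h c ⟨[], T⟩ ⟨T z, update T z []⟩ := .pull [] (by simp) (by grind)
  have hpull_x : Shunt h c ⟨T z, update T z []⟩ ⟨T z ++ [x], T₁⟩ :=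
    .pull (A := [x]) (T z) (by grind) hz
  have hpush_x : Shunt h c ⟨T z ++ [x], T₁⟩ ⟨T z, T₂⟩ := .push (T z) (by grind)
  have hbottom := (hpull_z.within.tail hpull_x).tail hpush_x
  rcases (hT z).lt_or_eq with hlt | hfull
  · have hpush_z : Shunt h c ⟨T z, T₂⟩ ⟨[], update T₂ z (T z ++ T₂ z)⟩ := .push [] (by grind)
    exact ⟨_, T z, (hbottom.tail hpush_z).mono (by omega), by grind⟩
  · obtain ⟨t, Z, hZ⟩ := List.exists_cons_of_length_pos (hfull ▸ hcz)
    set T₃ := update T₂ z (Z ++ T₂ z)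
    have hTu := hT u
    have hpush_Z : Shunt h c ⟨T z, T₂⟩ ⟨[t], T₃⟩ := by
      rw [hZ]
      exact .push [t] (by grind)
    have hpush_t : Shunt h c ⟨[t], T₃⟩ ⟨[], update T₃ u ([t] ++ T₃ u)⟩ := .push [] (by grind)
    exact ⟨_, Z, (hbottom.tail hpush_Z).tail hpush_t, by grind⟩

end Within

end Place

section ShortHeadshunt

variable {α ι : Type*} [DecidableEq ι] {h : ℕ} {c : ι → ℕ} {T : ι → List α} {x : α}
  {A B U : List α} {p r v z : ι} {k : ℕ}

theorem Within.exchange (hvz : v ≠ z) (hvp : v ≠ p) (hpz : p ≠ z) (hh : 1 ≤ h)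
    (hv : (T v).length = c v) (hcv : 0 < c v) (hz : (T z).length < c z) (hp : T p = x :: U) :
    ∃ T' V, Within h c 4 ⟨[], T⟩ ⟨[], T'⟩ ∧ T' v = x :: V ∧ (T' v).length = c v ∧
      (T' z).length = (T z).length + 1 := by
  obtain ⟨t, V, hV⟩ := List.exists_cons_of_length_pos (hv ▸ hcv)
  have hfree := Within.transfer (h := h) (c := c) [] hV hvz hz hh
  set T₁ := update (update T v V) z (t :: T z)
  have hfill := Within.transfer (h := h) (c := c) (T := T₁) (i := p) (j := v) (a := x) (B := U) []
    (by grind) hvp.symm (by grind) hh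
  exact ⟨_, V, hfree.trans hfill, by grind, by grind, by grind⟩

variable [Fintype ι]

theorem sum_eq_add_add_sum_compl (hpz : p ≠ z) (f : ι → ℕ) :
    ∑ i, f i = f z + f p + ∑ i ∈ {z, p}ᶜ, f i := by
  rw [← Finset.sum_add_sum_compl {z, p}, Finset.sum_pair hpz.symm]

namespace Within

theorem expose (hh : 1 ≤ h) (hk : ∑ i, (T i).length = k) (hc : k + c r ≤ ∑ i, c i) (z : ι)
    (hr : T r = A ++ x :: B) :
    ∃ T' p U, Within h c (2 * k) ⟨[], T⟩ ⟨[], T'⟩ ∧ p ≠ z ∧ T' p = x :: U := by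
  have hTr : (T r).length = A.length + B.length + 1 := by grind
  rw [Fintype.sum_eq_add_sum_compl r] at hk hc
  obtain ⟨T₁, hdrain, hTr₁, -, hsum⟩ := drain (h := h) (c := c) {r}ᶜ (by simp) (H := []) hh hr
    (by omega)
  by_cases hrz : r = z
  · obtain ⟨u, hu, hlt⟩ : ∃ u ∈ ({r}ᶜ : Finset ι), (T₁ u).length < c u :=
      Finset.exists_lt_of_sum_lt (by omega)
    have hur : u ≠ r := by simpa using hu
    have htransfer := transfer (h := h) (c := c) [] hTr₁ hur.symm hlt hh
    exact ⟨_, u, T₁ u, (hdrain.trans htransfer).mono (by omega), hrz ▸ hur, by grind⟩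
  · exact ⟨T₁, r, B, hdrain.mono (by omega), hrz, hTr₁⟩

theorem empty_of_full (hh : 1 ≤ h) (hk : ∑ i, (T i).length = k) (hc : k + c z ≤ ∑ i, c i)
    (hpz : p ≠ z) (hp : (T p).length = c p) :
    ∃ T', Within h c (2 * (T z).length) ⟨[], T⟩ ⟨[], T'⟩ ∧ T' z = [] ∧ T' p = T p := by
  rw [sum_eq_add_add_sum_compl hpz] at hk hc
  obtain ⟨T', hdrain, hTz, hne, -⟩ := drain (h := h) (c := c) {z, p}ᶜ (by simp) (H := []) hh
    (T z).append_nil.symm (by omega)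
  exact ⟨T', hdrain, hTz, hne p (by simp) hpz⟩

/-- If siding `z` does not fit into the free places of the sidings other than `p`, then filling
these places makes every such siding full, and `x` can be exchanged for the top wagon of one of
them; from then on the siding with `x` on top need not be touched. -/
theorem empty (hT : ∀ i, (T i).length ≤ c i) (hh : 1 ≤ h) (hk : ∑ i, (T i).length = k)
    (hc : ∀ i, k + c i ≤ ∑ i, c i) (hpz : p ≠ z) (hv : ∃ v, v ≠ z ∧ v ≠ p ∧ 0 < c v)
    (hp : T p = x :: U) :
    ∃ T' q V, Within h c (2 * k + 4) ⟨[], T⟩ ⟨[], T'⟩ ∧ q ≠ z ∧ T' q = x :: V ∧ T' z = [] := by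
  have hcz := hc z
  have hcp := hc p
  have hTp : 0 < (T p).length := by simp [hp]
  have hTk := hk
  rw [sum_eq_add_add_sum_compl hpz] at hTk hcz hcp
  have hle := Finset.sum_le_sum (s := ({z, p} : Finset ι)ᶜ) fun i _ => hT i
  by_cases hroom : ∑ i ∈ {z, p}ᶜ, (T i).length + (T z).length ≤ ∑ i ∈ {z, p}ᶜ, c i
  · obtain ⟨T', hdrain, hTz, hne, -⟩ := drain (h := h) (c := c) {z, p}ᶜ (by simp) (H := []) hh
      (T z).append_nil.symm hroom
    exact ⟨T', p, U, hdrain.mono (by omega), hpz, (hne p (by simp) hpz).trans hp, hTz⟩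
  · obtain ⟨A₁, A₂, hA, hA₁⟩ := exists_eq_append_of_le_length (l := T z)
      (n := ∑ i ∈ {z, p}ᶜ, c i - ∑ i ∈ {z, p}ᶜ, (T i).length) (by omega)
    obtain ⟨T₁, hdrain, hTz₁, hne, hsum⟩ := drain (h := h) (c := c) {z, p}ᶜ (by simp) (H := []) hh
      hA (by omega)
    have hlen : (T z).length = A₁.length + (T₁ z).length := by simp [hA, hTz₁]
    obtain ⟨v, hvz, hvp, hcv⟩ := hv
    have hT₁ : ∀ i, (T₁ i).length ≤ c i := (hdrain.fits ⟨by simp, hT⟩).siding_le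
    have hfull : (T₁ v).length = c v :=
      length_eq_of_sum_le hT₁ (D := {z, p}ᶜ) (by omega) (by simp [hvz, hvp])
    obtain ⟨T₂, V, hexchange, hV, hfull₂, hTz₂⟩ := exchange (h := h) hvz hvp hpz hh hfull hcv
      (by omega) ((hne p (by simp) hpz).trans hp)
    have hk₂ : ∑ i, (T₂ i).length = k := by
      simpa [hk] using (hdrain.trans hexchange).sum_length_eq.symm
    obtain ⟨T', hempty, hTz', hTv⟩ := empty_of_full hh hk₂ (hc z) hvz hfull₂
    exact ⟨T', v, V, ((hdrain.trans hexchange).trans hempty).mono (by grind), hvz,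
      hTv.trans hV, hTz'⟩

end Within

end ShortHeadshunt

section Rearrange

theorem length_update_le_update_sub_one {α ι : Type*} [DecidableEq ι] {c : ι → ℕ}
    {T : ι → List α} {z : ι} {x : α} {B : List α}
    (hT : ∀ i, (T i).length ≤ c i) (hz : T z = B ++ [x]) (i : ι) :
    (update T z B i).length ≤ update c z (c z - 1) i := by
  have := hT i
  grind

theorem Within.of_update_bottom {α ι : Type*} [DecidableEq ι] {h n : ℕ} {c : ι → ℕ} {H K : List α}
    {T Q : ι → List α} {z : ι} {x : α} {A B : List α} (hT : T z = A ++ [x]) (hQ : Q z = B ++ [x])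
    (hz : 0 < c z)
    (hn : Within h (update c z (c z - 1)) n ⟨H, update T z A⟩ ⟨K, update Q z B⟩) :
    Within h c n ⟨H, T⟩ ⟨K, Q⟩ := by
  have hextend := hn.extend (c := c) (B := update (fun _ => []) z [x]) (by grind)
  have hbottom : ∀ {H : List α} {T : ι → List α} {B : List α}, T z = B ++ [x] →
      (Yard.mk H (update T z B)).extend (update (fun _ => []) z [x]) = ⟨H, T⟩ := by
    intro H T B hB
    exact congrArg (Yard.mk H) (funext fun i => by grind)
  rwa [hbottom hT, hbottom hQ] at hextend

variable {α ι : Type*} [Fintype ι] {h : ℕ} {c : ι → ℕ} {k : ℕ}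

/-- The conditions under which `k` wagons standing in sidings of lengths `c`, some of which may be
zero, can be rearranged arbitrarily with a headshunt of length `h`. -/
structure Spacious (k h : ℕ) (c : ι → ℕ) : Prop where
  one_le : 1 ≤ h
  le_sum : k ≤ ∑ i, c i
  add_lt : ∀ i, k + c i < h + ∑ i, c i
  sidings : (2 ≤ h ∧ 2 ≤ #{i | 0 < c i}) ∨ 3 ≤ #{i | 0 < c i}

namespace Spacious

theorem exists_ne (hs : Spacious k h c) (z : ι) : ∃ u, u ≠ z ∧ 0 < c u := by
  have hcard : 1 < #{i | 0 < c i} := by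
    have := hs.sidings
    omega
  obtain ⟨u, hu, huz⟩ := Finset.exists_mem_ne hcard z
  exact ⟨u, huz, by simpa using hu⟩

/-- Each siding holding one of the `k + 1 ≥ 3` target wagons has length `1`, so there are at least
`k + 1` nonempty sidings; for `h = 1` the free places force one more. -/
theorem lt_card_of_le_one (hs : Spacious (k + 1) h c) (hk : 2 ≤ k) {t : ι → ℕ}
    (htc : ∀ i, t i ≤ c i) (ht : ∑ i, t i = k + 1) (hone : ∀ i, 0 < t i → c i ≤ 1) :
    (2 ≤ h ∧ 2 < #{i | 0 < c i}) ∨ 3 < #{i | 0 < c i} := by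
  have hle : ∀ i, t i ≤ if 0 < c i then 1 else 0 := fun i => by
    have := htc i
    have := hone i
    grind
  have hcard : ∑ i, t i ≤ #{i | 0 < c i} := by
    rw [Finset.card_filter]
    exact Finset.sum_le_sum fun i _ => hle i
  by_cases hh : 2 ≤ h
  · omega
  obtain ⟨u, hu⟩ : ∃ u, 0 < t u := by
    simpa [Nat.pos_iff_ne_zero] using (Finset.sum_pos_iff.1 (show 0 < ∑ i, t i by omega))
  have hfree : ∑ i, t i < ∑ i, c i := by
    have := hs.add_lt u
    have := htc u
    omega
  obtain ⟨i, -, hi⟩ := Finset.exists_lt_of_sum_lt hfree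
  have hcard' : ∑ i, t i < #{i | 0 < c i} := by
    rw [Finset.card_filter]
    refine Finset.sum_lt_sum (fun i _ => hle i) ⟨i, mem_univ i, ?_⟩
    have := hone i
    grind
  omega

theorem exists_ne_ne (hs : Spacious k h c) (hh : h < 2) (z p : ι) :
    ∃ u, u ≠ z ∧ u ≠ p ∧ 0 < c u := by
  classical
  have hcard : #{z, p} < #{i | 0 < c i} := by
    have := hs.sidings
    have := Finset.card_le_two (a := z) (b := p)
    omega
  obtain ⟨u, hu, hne⟩ := Finset.exists_mem_notMem_of_card_lt_card hcard
  simp only [mem_insert, mem_singleton, not_or] at hne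
  exact ⟨u, hne.1, hne.2, by simpa using hu⟩

end Spacious

namespace Yard

variable {T Q : ι → List α}

theorem sum_length_eq (hTQ : (Yard.mk [] T).contents = (Yard.mk [] Q).contents) :
    ∑ i, (T i).length = ∑ i, (Q i).length := by
  simpa [card_contents] using congrArg Multiset.card hTQ

theorem exists_eq_append_cons_of_mem_contents {x : α}
    (hx : x ∈ (Yard.mk [] T).contents) : ∃ r A B, T r = A ++ x :: B := by
  obtain ⟨r, -, hr⟩ : ∃ r ∈ univ, x ∈ (T r : Multiset α) := by
    simpa only [contents, Multiset.coe_nil, zero_add, Multiset.mem_sum] using hx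
  exact ⟨r, List.append_of_mem (Multiset.mem_coe.1 hr)⟩

end Yard

variable [DecidableEq ι] {z : ι}

theorem sum_update_sub_one (hz : 0 < c z) : ∑ i, update c z (c z - 1) i + 1 = ∑ i, c i := by
  rw [Finset.sum_update_of_mem (mem_univ z), ← Finset.add_sum_erase univ c (mem_univ z),
    Finset.sdiff_singleton_eq_erase]
  omega

theorem filter_update_sub_one (hz : 2 ≤ c z) :
    ({i | 0 < update c z (c z - 1) i} : Finset ι) = ({i | 0 < c i} : Finset ι) := by
  grind

theorem card_filter_le_card_filter_update_sub_one_add_one (c : ι → ℕ) (z : ι) :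
    #{i | 0 < c i} ≤ #{i | 0 < update c z (c z - 1) i} + 1 := by
  have hsub : ({i | 0 < c i} : Finset ι).erase z ⊆
      ({i | 0 < update c z (c z - 1) i} : Finset ι) := by
    grind
  have := Finset.card_le_card hsub
  have := Finset.pred_card_le_card_erase (s := ({i | 0 < c i} : Finset ι)) (a := z)
  omega

namespace Spacious

theorem exists_pred (hs : Spacious (k + 1) h c) (hk : 2 ≤ k) {t : ι → ℕ} (htc : ∀ i, t i ≤ c i)
    (ht : ∑ i, t i = k + 1) : ∃ z, 0 < t z ∧ Spacious k h (update c z (c z - 1)) := by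
  suffices hsidings : ∃ z, 0 < t z ∧ ((2 ≤ h ∧ 2 ≤ #{i | 0 < update c z (c z - 1) i}) ∨
      3 ≤ #{i | 0 < update c z (c z - 1) i}) by
    obtain ⟨z, hz, hsidings⟩ := hsidings
    have hsum := sum_update_sub_one (hz.trans_le (htc z))
    refine ⟨z, hz, hs.one_le, ?_, fun i => ?_, hsidings⟩
    · have := hs.le_sum
      omega
    · have := hs.add_lt i
      have : update c z (c z - 1) i ≤ c i := by grind
      omega
  by_cases htwo : ∃ z, 0 < t z ∧ 2 ≤ c z
  · obtain ⟨z, hz, hcz⟩ := htwo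
    exact ⟨z, hz, filter_update_sub_one hcz ▸ hs.sidings⟩
  · push Not at htwo
    obtain ⟨z, -, hz⟩ := Finset.sum_pos_iff.1 (show 0 < ∑ i, t i by omega)
    have hcard := hs.lt_card_of_le_one hk htc ht fun i hi => Nat.le_of_lt_succ (htwo i hi)
    have := card_filter_le_card_filter_update_sub_one_add_one c z
    exact ⟨z, hz, by omega⟩

end Spacious

namespace Within

variable {T : ι → List α} {r : ι} {x : α} {A B : List α}

theorem place_of_two_le (hT : ∀ i, (T i).length ≤ c i) (hk : ∑ i, (T i).length = k) (hk2 : 2 ≤ k)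
    (hs : Spacious k h c) (hh : 2 ≤ h) (hr : T r = A ++ x :: B) (hz : 0 < c z) :
    ∃ T' B', Within h c (4 * k + 8) ⟨[], T⟩ ⟨[], T'⟩ ∧ T' z = B' ++ [x] := by
  obtain ⟨T₁, hisolate⟩ := isolate hT hh (hs.exists_ne r) hk hk2 (hs.add_lt r) hr
  have hT₁ := hisolate.fits ⟨by simp, hT⟩
  have hk₁ : 1 + ∑ i, (T₁ i).length = k := by simpa [hk] using hisolate.sum_length_eq.symm
  obtain ⟨T₂, u, U, hstow, huz, hu, hlt⟩ := stow (x := x) hT₁.siding_le hh (hs.exists_ne z) hk₁ hk2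
    hs.le_sum (hs.add_lt z)
  obtain ⟨T₃, B', hbury, hB'⟩ := bury (hstow.fits hT₁).siding_le huz hu hlt hz
  exact ⟨T₃, B', ((hisolate.trans hstow).trans hbury).mono (by omega), hB'⟩

theorem place_of_lt_two (hT : ∀ i, (T i).length ≤ c i) (hk : ∑ i, (T i).length = k)
    (hs : Spacious k h c) (hh : h < 2) (hr : T r = A ++ x :: B) (hz : 0 < c z) :
    ∃ T' B', Within h c (4 * k + 8) ⟨[], T⟩ ⟨[], T'⟩ ∧ T' z = B' ++ [x] := by
  have hc : ∀ i, k + c i ≤ ∑ i, c i := fun i => by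
    have := hs.add_lt i
    omega
  obtain ⟨T₁, p, U, hexpose, hpz, hp⟩ := expose hs.one_le hk (hc r) z hr
  have hk₁ : ∑ i, (T₁ i).length = k := by simpa [hk] using hexpose.sum_length_eq.symm
  obtain ⟨T₂, q, V, hempty, hqz, hq, hz₂⟩ := empty (hexpose.fits ⟨by simp, hT⟩).siding_le hs.one_le
    hk₁ hc hpz (hs.exists_ne_ne hh z p) hp
  have htransfer := transfer (h := h) (c := c) [] hq hqz (by simpa [hz₂] using hz) hs.one_le
  exact ⟨_, [], ((hexpose.trans hempty).trans htransfer).mono (by omega), by simp [hz₂]⟩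

theorem place (hT : ∀ i, (T i).length ≤ c i) (hk : ∑ i, (T i).length = k) (hk2 : 2 ≤ k)
    (hs : Spacious k h c) (hr : T r = A ++ x :: B) (hz : 0 < c z) :
    ∃ T' B', Within h c (4 * k + 8) ⟨[], T⟩ ⟨[], T'⟩ ∧ T' z = B' ++ [x] := by
  rcases lt_or_ge h 2 with hh | hh
  · exact place_of_lt_two hT hk hs hh hr hz
  · exact place_of_two_le hT hk hk2 hs hh hr hz

end Within

namespace Yard

theorem contents_eq_add_singleton {H : List α} {T : ι → List α} {x : α} {B : List α}
    (hT : T z = B ++ [x]) :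
    (Yard.mk H T).contents = (Yard.mk H (update T z B)).contents + {x} := by
  have hcompl : ∑ i ∈ {z}ᶜ, (update T z B i : Multiset α) = ∑ i ∈ {z}ᶜ, (T i : Multiset α) :=
    Finset.sum_congr rfl fun i hi => by rw [update_of_ne (by simpa using hi)]
  simp only [contents, Fintype.sum_eq_add_sum_compl z, hcompl, update_self, hT,
    ← Multiset.coe_add, Multiset.coe_singleton]
  abel

theorem contents_update_nil (r : ι) (x : α) :
    (Yard.mk [] (update (fun _ => []) r [x])).contents = {x} := by
  rw [contents, Fintype.sum_eq_single r fun i hi => by simp [hi]]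
  simp

theorem exists_eq_update_nil {T : ι → List α} (hT : ∑ i, (T i).length = 1) :
    ∃ r x, T = update (fun _ => []) r [x] := by
  obtain ⟨r, -, hr⟩ := Finset.sum_pos_iff.1 (show 0 < ∑ i, (T i).length by omega)
  rw [← Finset.add_sum_erase univ _ (mem_univ r)] at hT
  obtain ⟨x, hx⟩ := List.length_eq_one_iff.1 (show (T r).length = 1 by omega)
  refine ⟨r, x, funext fun i => ?_⟩
  by_cases hi : i = r
  · rw [hi, hx, update_self]
  · rw [update_of_ne hi]
    exact List.length_eq_zero_iff.1 (Finset.sum_eq_zero_iff.1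
      (show ∑ i ∈ univ.erase r, (T i).length = 0 by omega) i (by simp [hi]))

end Yard

namespace Within

variable {n : ℕ} {T Q : ι → List α} {x : α} {Q' : List α}

theorem rearrange_single (hh : 1 ≤ h) (hQ : ∀ i, (Q i).length ≤ c i)
    (hTQ : (Yard.mk [] T).contents = (Yard.mk [] Q).contents) (hT1 : ∑ i, (T i).length = 1)
    (hQ1 : ∑ i, (Q i).length = 1) : Within h c 2 ⟨[], T⟩ ⟨[], Q⟩ := by
  obtain ⟨r, x, rfl⟩ := Yard.exists_eq_update_nil hT1
  obtain ⟨z, y, rfl⟩ := Yard.exists_eq_update_nil hQ1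
  obtain rfl : x = y := by simpa only [Yard.contents_update_nil, Multiset.singleton_inj] using hTQ
  by_cases hrz : r = z
  · exact hrz ▸ .refl _ _
  · have hz := hQ z
    have htransfer := transfer (h := h) (c := c) [] (update_self r [x] fun _ => []) hrz (by grind)
      hh
    rwa [update_idem, update_of_ne (Ne.symm hrz), update_eq_self] at htransfer

theorem rearrange_of_update_bottom (hk : 2 ≤ k) (hs : Spacious k h c)
    (hT : ∀ i, (T i).length ≤ c i) (hTQ : (Yard.mk [] T).contents = (Yard.mk [] Q).contents)
    (hTk : ∑ i, (T i).length = k) (hz : 0 < c z) (hQz : Q z = Q' ++ [x])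
    (hrest : ∀ T' : ι → List α, (∀ i, (T' i).length ≤ update c z (c z - 1) i) →
      (Yard.mk [] T').contents = (Yard.mk [] (update Q z Q')).contents →
      Within h (update c z (c z - 1)) n ⟨[], T'⟩ ⟨[], update Q z Q'⟩) :
    Within h c (4 * k + 8 + n) ⟨[], T⟩ ⟨[], Q⟩ := by
  obtain ⟨r, A, B, hr⟩ := Yard.exists_eq_append_cons_of_mem_contents (T := T) (x := x) (by
    rw [hTQ, Yard.contents_eq_add_singleton hQz]
    exact Multiset.mem_add.2 (.inr (Multiset.mem_singleton_self x)))
  obtain ⟨T₁, B', hplace, hB'⟩ := place hT hTk hk hs hr hz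
  have hT₁ := (hplace.fits ⟨by simp, hT⟩).siding_le
  refine hplace.trans (of_update_bottom hB' hQz hz (hrest _ ?_ ?_))
  · exact length_update_le_update_sub_one hT₁ hB'
  · refine add_right_cancel (b := {x}) ?_
    rw [← Yard.contents_eq_add_singleton hB', ← Yard.contents_eq_add_singleton hQz,
      ← hplace.contents_eq, hTQ]

theorem rearrange (hh : 1 ≤ h) (hk : 1 ≤ k) (hs : 2 ≤ k → Spacious k h c)
    (hT : ∀ i, (T i).length ≤ c i) (hQ : ∀ i, (Q i).length ≤ c i)
    (hTQ : (Yard.mk [] T).contents = (Yard.mk [] Q).contents) (hQk : ∑ i, (Q i).length = k) :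
    Within h c (2 * k ^ 2 + 10 * k - 10) ⟨[], T⟩ ⟨[], Q⟩ := by
  induction k, hk using Nat.le_induction generalizing c T Q with
  | base => exact rearrange_single hh hQ hTQ (Yard.sum_length_eq hTQ ▸ hQk) hQk
  | succ k hk ih =>
    obtain ⟨z, hz, hsz⟩ : ∃ z, 0 < (Q z).length ∧
        (2 ≤ k → Spacious k h (update c z (c z - 1))) := by
      by_cases hk2 : 2 ≤ k
      · obtain ⟨z, hz, hsz⟩ := (hs (by omega)).exists_pred hk2 hQ hQk
        exact ⟨z, hz, fun _ => hsz⟩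
      · obtain ⟨z, -, hz⟩ := Finset.sum_pos_iff.1 (show 0 < ∑ i, (Q i).length by omega)
        exact ⟨z, hz, fun h => absurd h hk2⟩
    obtain ⟨Q', x, hQz⟩ : ∃ Q' x, Q z = Q' ++ [x] :=
      ⟨_, _, (List.dropLast_append_getLast (List.ne_nil_of_length_pos hz)).symm⟩
    have hQk' : ∑ i, (update Q z Q' i).length = k := by
      simpa [Yard.card_contents, hQk] using
        congrArg Multiset.card (Yard.contents_eq_add_singleton (H := []) hQz).symm
    have hrest := fun T' hT' hTQ' =>
      ih hsz (T := T') hT' (length_update_le_update_sub_one hQ hQz) hTQ' hQk'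
    exact (rearrange_of_update_bottom (by omega) (hs (by omega)) hT hTQ
      (Yard.sum_length_eq hTQ ▸ hQk) (hz.trans_le (hQ z)) hQz hrest).mono (by grind)

end Within

end Rearrange

section Position

variable {W : Type*} {s h n : ℕ} {m : Fin s → ℕ}

namespace Position

/-- The headshunt and the sidings of a position. -/
def yard (p : Position W h m) : Yard W (Fin s) :=
  ⟨p.track 0, fun i => p.track i.succ⟩

theorem yard_injective : Injective (yard : Position W h m → Yard W (Fin s)) := by
  intro p q hpq
  ext1
  funext i
  refine Fin.cases ?_ (fun i => ?_) i
  · exact congrArg Yard.headshunt hpq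
  · exact congrFun (congrArg Yard.siding hpq) i

theorem fits_yard (p : Position W h m) : p.yard.Fits h m :=
  ⟨p.headshunt_le, p.siding_le⟩

theorem eq_of_mem_track (p : Position W h m) {i j : Fin (s + 1)} {a : W} (hi : a ∈ p.track i)
    (hj : a ∈ p.track j) : i = j :=
  by_contra fun hij => p.disjoint i j hij hi hj

theorem contents_yard_eq_sum (p : Position W h m) :
    p.yard.contents = ∑ i, (p.track i : Multiset W) := by
  rw [Fin.sum_univ_succ]
  rfl

theorem mem_contents_yard (p : Position W h m) (a : W) : a ∈ p.yard.contents := by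
  obtain ⟨i, hi⟩ := p.cover a
  exact p.contents_yard_eq_sum ▸ Multiset.mem_sum.2 ⟨i, mem_univ i, hi⟩

theorem nodup_contents_yard (p : Position W h m) : p.yard.contents.Nodup := by
  classical
  refine Multiset.nodup_iff_count_le_one.2 fun a => ?_
  obtain ⟨i, hi⟩ := p.cover a
  rw [contents_yard_eq_sum, Multiset.count_sum', Finset.sum_eq_single i fun j _ hj =>
    Multiset.count_eq_zero_of_notMem fun haj => hj (p.eq_of_mem_track haj hi)]
  · exact Multiset.nodup_iff_count_le_one.1 (Multiset.coe_nodup.2 (p.nodup i)) a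
  · simp

theorem contents_yard_eq (p q : Position W h m) : p.yard.contents = q.yard.contents :=
  (Multiset.Nodup.ext p.nodup_contents_yard q.nodup_contents_yard).2 fun a =>
    iff_of_true (p.mem_contents_yard a) (q.mem_contents_yard a)

theorem length_add_sum [Fintype W] (p : Position W h m) :
    (p.track 0).length + ∑ i : Fin s, (p.track i.succ).length = Fintype.card W := by
  classical
  have huniv : p.yard.contents = (univ : Finset W).val :=
    (Multiset.Nodup.ext p.nodup_contents_yard univ.nodup).2 fun a =>
      iff_of_true (p.mem_contents_yard a) (mem_univ a)
  exact (Yard.card_contents p.yard).symm.trans (congrArg Multiset.card huniv)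

theorem exists_yard_eq {y : Yard W (Fin s)} (hy : y.Fits h m) (hnodup : y.contents.Nodup)
    (hmem : ∀ a, a ∈ y.contents) : ∃ p : Position W h m, p.yard = y := by
  set t : Fin (s + 1) → List W := Fin.cons y.headshunt y.siding
  have hsum : y.contents = ∑ i, (t i : Multiset W) := by
    rw [Fin.sum_univ_succ]
    rfl
  rw [hsum] at hnodup hmem
  refine ⟨⟨t, fun i => ?_, fun a => ?_, fun i j hij a hi hj => ?_, hy.siding_le, hy.headshunt_le⟩,
    rfl⟩
  · exact Multiset.coe_nodup.1 (Multiset.nodup_of_le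
      (Finset.single_le_sum (f := fun i => (t i : Multiset W)) (fun _ _ => zero_le) (mem_univ i))
      hnodup)
  · obtain ⟨i, -, hi⟩ := Multiset.mem_sum.1 (hmem a)
    exact ⟨i, hi⟩
  · have hle : (t i : Multiset W) + t j ≤ ∑ i, (t i : Multiset W) := by
      rw [← Finset.sum_pair (f := fun i => (t i : Multiset W)) hij]
      exact Finset.sum_le_sum_of_subset (subset_univ _)
    exact Multiset.disjoint_left.1 (Multiset.nodup_add.1 (Multiset.nodup_of_le hle hnodup)).2.2
      hi hj

end Position

theorem Within.exists_yard_eq {p : Position W h m} {y : Yard W (Fin s)}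
    (hpy : Within h m n p.yard y) : ∃ q : Position W h m, q.yard = y :=
  Position.exists_yard_eq (hpy.fits p.fits_yard) (hpy.contents_eq ▸ p.nodup_contents_yard)
    fun a => hpy.contents_eq ▸ p.mem_contents_yard a

theorem Shunt.eq_or_isMove {p q : Position W h m} (hpq : Shunt h m p.yard q.yard) :
    p = q ∨ IsMove p q :=
  or_iff_not_imp_left.2 fun hne => ⟨hne, hpq.exists_append_eq⟩

theorem Within.exists_walk {p q : Position W h m} (hpq : Within h m n p.yard q.yard) :
    ∃ γ : (graph W h m).Walk p q, γ.length ≤ n := by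
  generalize hx : p.yard = x at hpq
  generalize hy : q.yard = y at hpq
  induction hpq generalizing q with
  | refl =>
    obtain rfl := Position.yard_injective (hx.trans hy.symm)
    exact ⟨.nil, Nat.zero_le _⟩
  | tail hxy hyz ih =>
    subst hx hy
    obtain ⟨q', rfl⟩ := hxy.exists_yard_eq
    obtain ⟨γ, hγ⟩ := ih rfl rfl
    rcases hyz.eq_or_isMove with rfl | hmove
    · exact ⟨γ, hγ.trans (Nat.le_succ _)⟩
    · have hadj : (graph W h m).Adj q' q := hmove
      exact ⟨γ.concat hadj, by rw [SimpleGraph.Walk.length_concat]; omega⟩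

variable [Fintype W]

theorem exists_walk_clear (p : Position W h m) (hw : Fintype.card W ≤ ∑ i, m i) :
    ∃ (q : Position W h m) (γ : (graph W h m).Walk p q), q.track 0 = [] ∧
      γ.length ≤ Fintype.card W := by
  have hlen := p.length_add_sum
  obtain ⟨T, hclear⟩ := Within.clear_headshunt (h := h) (c := m) p.yard.headshunt p.yard.siding
    (hlen.trans_le hw)
  obtain ⟨q, hq⟩ := hclear.exists_yard_eq
  obtain ⟨γ, hγ⟩ := (hq ▸ hclear :).exists_walk
  exact ⟨q, γ, congrArg Yard.headshunt hq, hγ.trans (hlen ▸ Nat.le_add_right _ _)⟩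

theorem exists_walk_of_spacious (hh : 1 ≤ h) (hw : 1 ≤ Fintype.card W)
    (hwm : Fintype.card W ≤ ∑ i, m i)
    (hs : 2 ≤ Fintype.card W → Spacious (Fintype.card W) h m) (p q : Position W h m) :
    ∃ γ : (graph W h m).Walk p q,
      γ.length + 10 ≤ 2 * Fintype.card W ^ 2 + 12 * Fintype.card W := by
  obtain ⟨p', γ₁, hp', hγ₁⟩ := exists_walk_clear p hwm
  obtain ⟨q', γ₂, hq', hγ₂⟩ := exists_walk_clear q hwm
  have hp : p'.yard = ⟨[], p'.yard.siding⟩ := congrArg (Yard.mk · p'.yard.siding) hp'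
  have hq : q'.yard = ⟨[], q'.yard.siding⟩ := congrArg (Yard.mk · q'.yard.siding) hq'
  have hlen : ∑ i, (q'.yard.siding i).length = Fintype.card W := by
    rw [← q'.length_add_sum, hq', List.length_nil, zero_add]
    rfl
  have hrearrange := Within.rearrange hh hw hs p'.siding_le q'.siding_le
    (hp ▸ hq ▸ p'.contents_yard_eq q') hlen
  obtain ⟨γ₃, hγ₃⟩ := (hp ▸ hq ▸ hrearrange : Within h m _ p'.yard q'.yard).exists_walk
  refine ⟨(γ₁.append γ₃).append γ₂.reverse, ?_⟩
  simp only [SimpleGraph.Walk.length_append, SimpleGraph.Walk.length_reverse]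
  omega

end Position

section Natural

variable {W : Type*} {s h : ℕ} {m : Fin s → ℕ}

theorem reverse_eq_self_of_length_le_one {α : Type*} {l : List α} (hl : l.length ≤ 1) :
    l.reverse = l := by
  match l, hl with
  | [], _ => rfl
  | [_], _ => rfl

theorem IsMove.length_headshunt_ne {p q : Position W h m} (hpq : IsMove p q) :
    (p.track 0).length ≠ (q.track 0).length := by
  obtain ⟨hne, r, hr, happend⟩ := hpq
  intro hlen
  obtain ⟨hheadshunt, hsiding⟩ := List.append_inj happend hlen
  refine hne (Position.yard_injective (congrArg₂ Yard.mk hheadshunt (funext fun i => ?_)))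
  rcases eq_or_ne i r with rfl | hir
  · exact hsiding
  · exact hr i hir

theorem Position.length_headshunt_of_siding_eq_nil [Fintype W] {z : Fin s}
    (hz : h + ∑ i, m i ≤ Fintype.card W + m z) {p : Position W h m} (hp : p.track z.succ = []) :
    (p.track 0).length = h := by
  have hlen := p.length_add_sum
  have hle := Finset.sum_le_sum fun i (_ : i ∈ ({z} : Finset (Fin s))ᶜ) => p.siding_le i
  have hheadshunt := p.headshunt_le
  rw [Fintype.sum_eq_add_sum_compl z, hp, List.length_nil] at hlen
  rw [Fintype.sum_eq_add_sum_compl z] at hz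
  omega

/-- `L` reads off a list of wagons from every position, compatibly with permutations of the wagons
and such that no move changes its last wagon. In a natural puzzle the wagons of a starting position
can be permuted so as to make this last wagon any prescribed one, which makes the puzzle unsolvable
unless this wagon is unrelated to the one prescribed in the finishing positions. -/
structure HasInvariantLast (L : Position W h m → List W) : Prop where
  ne_nil : ∀ p, L p ≠ []
  permute : ∀ (σ : Equiv.Perm W) (p), L (p.permute σ) = (L p).map σ
  getLast?_eq : ∀ p q, IsMove p q → (L p).getLast? = (L q).getLast?

namespace HasInvariantLast

theorem getLast?_eq_of_walk {L : Position W h m → List W} (hL : HasInvariantLast L)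
    {p q : Position W h m} (γ : (graph W h m).Walk p q) : (L p).getLast? = (L q).getLast? := by
  induction γ with
  | nil => rfl
  | cons hadj _ ih => exact (hL.getLast?_eq _ _ hadj).trans ih

theorem exists_finish [Fintype W] {P : Puzzle W} {L : Position W P.h P.m → List W}
    (hL : HasInvariantLast L) (hN : P.IsNatural) (hP : P.AlwaysSolvable) (hS : P.S.Nonempty)
    (b : W) : ∃ q ∈ P.F, (L q).getLast? = some b := by
  classical
  obtain ⟨p, hp⟩ := hS
  have hlast := List.getLast?_eq_some_getLast (hL.ne_nil p)
  set a := (L p).getLast (hL.ne_nil p)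
  obtain ⟨q, hq, ⟨γ⟩⟩ := hP _ (hN.1 p hp (Equiv.swap a b))
  refine ⟨q, hq, ?_⟩
  rw [← hL.getLast?_eq_of_walk γ, hL.permute, List.getLast?_map, hlast, Option.map_some,
    Equiv.swap_apply_left]

theorem of_forall_eq [Nonempty W] {z : Fin s} (hz : ∀ i, i = z) :
    HasInvariantLast fun p : Position W h m => p.track 0 ++ p.track z.succ where
  ne_nil p hnil := by
    obtain ⟨i, hi⟩ := p.cover (Classical.arbitrary W)
    rw [List.append_eq_nil_iff] at hnil
    rcases Fin.eq_zero_or_eq_succ i with rfl | ⟨i, rfl⟩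
    · exact List.ne_nil_of_mem hi hnil.1
    · exact List.ne_nil_of_mem hi (hz i ▸ hnil.2)
  permute σ p := List.map_append.symm
  getLast?_eq p q := by
    rintro ⟨-, r, -, happend⟩
    rw [← hz r, happend]

/-- A headshunt of length one cannot reverse anything, so that with two sidings the order of all
wagons along the line through the points is preserved. -/
theorem of_headshunt_le_one [Nonempty W] (hh : h ≤ 1) {o z : Fin s} (hoz : o ≠ z)
    (hs : ∀ i, i = z ∨ i = o) :
    HasInvariantLast fun p : Position W h m =>
      (p.track o.succ).reverse ++ p.track 0 ++ p.track z.succ where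
  ne_nil p hnil := by
    obtain ⟨i, hi⟩ := p.cover (Classical.arbitrary W)
    simp only [List.append_eq_nil_iff, List.reverse_eq_nil_iff] at hnil
    rcases Fin.eq_zero_or_eq_succ i with rfl | ⟨i, rfl⟩
    · exact List.ne_nil_of_mem hi hnil.1.2
    · rcases hs i with rfl | rfl
      · exact List.ne_nil_of_mem hi hnil.2
      · exact List.ne_nil_of_mem hi hnil.1.1
  permute σ p := by simp only [Position.permute, List.map_append, List.map_reverse]
  getLast?_eq p q := by
    rintro ⟨-, r, hr, happend⟩
    rcases hs r with rfl | rfl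
    · rw [List.append_assoc, List.append_assoc, happend, hr o hoz]
    · have hreverse := congrArg List.reverse happend
      rw [List.reverse_append, List.reverse_append,
        reverse_eq_self_of_length_le_one (p.headshunt_le.trans hh),
        reverse_eq_self_of_length_le_one (q.headshunt_le.trans hh)] at hreverse
      rw [hreverse, hr z hoz.symm]

variable [Fintype W]

theorem of_sum_lt_card (hw : ∑ i, m i < Fintype.card W) :
    HasInvariantLast fun p : Position W h m => (p.track 0).reverse :=
  have hne (p : Position W h m) : p.track 0 ≠ [] := fun hp => by
    have hlen := p.length_add_sum
    have hle := Finset.sum_le_sum fun i (_ : i ∈ univ) => p.siding_le i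
    rw [hp, List.length_nil] at hlen
    omega
  { ne_nil p := List.reverse_ne_nil_iff.2 (hne p)
    permute σ p := List.map_reverse.symm
    getLast?_eq p q := by
      rintro ⟨-, r, -, happend⟩
      rw [List.getLast?_reverse, List.getLast?_reverse, ← List.head?_append_of_ne_nil _ (hne p),
        happend, List.head?_append_of_ne_nil _ (hne q)] }

/-- When siding `z` is empty, all other tracks are full, so that `z` is the only siding the wagons
in the headshunt can be pushed into. -/
theorem of_le_card_add (hh : 0 < h) {z : Fin s} (hz : h + ∑ i, m i ≤ Fintype.card W + m z) :
    HasInvariantLast fun p : Position W h m => p.track 0 ++ p.track z.succ where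
  ne_nil p hnil := by
    rw [List.append_eq_nil_iff] at hnil
    have hlen := Position.length_headshunt_of_siding_eq_nil hz hnil.2
    rw [hnil.1, List.length_nil] at hlen
    omega
  permute σ p := List.map_append.symm
  getLast?_eq p q hpq := by
    obtain ⟨-, r, hr, happend⟩ := id hpq
    rcases eq_or_ne z r with rfl | hzr
    · rw [happend]
    have hsiding := hr z hzr
    have hp : p.track z.succ ≠ [] := fun hp => hpq.length_headshunt_ne <|
      (Position.length_headshunt_of_siding_eq_nil hz hp).trans
        (Position.length_headshunt_of_siding_eq_nil hz (hsiding ▸ hp)).symm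
    rw [List.getLast?_append_of_ne_nil _ hp, List.getLast?_append_of_ne_nil _ (hsiding ▸ hp),
      hsiding]

variable {P : Puzzle W} {z : Fin P.s} {ω : W}

theorem exists_not_disjoint {L : Position W P.h P.m → List W} (hL : HasInvariantLast L)
    (hN : P.IsNatural) (hP : P.AlwaysSolvable) (hS : P.S.Nonempty)
    (hω : ∀ q ∈ P.F, (q.track z.succ).getLast? = some ω) :
    ∃ q, ¬ (L q).Disjoint (q.track z.succ) := by
  obtain ⟨q, hq, hlast⟩ := hL.exists_finish hN hP hS ω
  exact ⟨q, fun hdisj =>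
    hdisj (List.mem_of_getLast? hlast) (List.mem_of_getLast? (hω q hq))⟩

theorem not_of_append (hN : P.IsNatural) (hP : P.AlwaysSolvable) (hS : P.S.Nonempty)
    (hw : 2 ≤ Fintype.card W) (hω : ∀ q ∈ P.F, (q.track z.succ).getLast? = some ω)
    (A : Position W P.h P.m → List W) :
    ¬ HasInvariantLast fun p => A p ++ p.track z.succ := by
  intro hL
  obtain ⟨b, hb⟩ := Fintype.exists_ne_of_one_lt_card hw ω
  obtain ⟨q, hq, hlast⟩ := hL.exists_finish hN hP hS b
  rw [List.getLast?_append, hω q hq, Option.some_or] at hlast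
  exact hb (Option.some_injective _ hlast.symm)

end HasInvariantLast

namespace Puzzle.IsNatural

variable [Fintype W] {P : Puzzle W}

theorem le_sum (hN : P.IsNatural) (hP : P.AlwaysSolvable) (hS : P.S.Nonempty) :
    Fintype.card W ≤ ∑ i, P.m i := by
  obtain ⟨-, z, ω, hω⟩ := id hN
  by_contra! hlt
  obtain ⟨q, hq⟩ := (HasInvariantLast.of_sum_lt_card hlt).exists_not_disjoint hN hP hS hω
  exact hq (List.disjoint_reverse_left.2 (q.disjoint 0 z.succ (Fin.succ_ne_zero z).symm))

theorem card_add_lt (hN : P.IsNatural) (hP : P.AlwaysSolvable) (hS : P.S.Nonempty)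
    (hw : 2 ≤ Fintype.card W) (i : Fin P.s) : Fintype.card W + P.m i < P.h + ∑ i, P.m i := by
  obtain ⟨-, z, ω, hω⟩ := id hN
  by_contra! hle
  have hL := HasInvariantLast.of_le_card_add P.h_pos hle
  rcases eq_or_ne i z with rfl | hiz
  · exact HasInvariantLast.not_of_append hN hP hS hw hω _ hL
  · obtain ⟨q, hq⟩ := hL.exists_not_disjoint hN hP hS hω
    exact hq (List.disjoint_append_left.2 ⟨q.disjoint 0 z.succ (Fin.succ_ne_zero z).symm,
      q.disjoint i.succ z.succ ((Fin.succ_injective _).ne hiz)⟩)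

theorem two_le_headshunt_or_three_le_sidings (hN : P.IsNatural) (hP : P.AlwaysSolvable)
    (hS : P.S.Nonempty) (hw : 2 ≤ Fintype.card W) : (2 ≤ P.h ∧ 2 ≤ P.s) ∨ 3 ≤ P.s := by
  obtain ⟨-, z, ω, hω⟩ := id hN
  have : Nonempty W := ⟨ω⟩
  by_contra! hs
  have hrev : ∀ i, i = z ∨ i = z.rev := fun i => by
    have hi := i.isLt
    simp only [Fin.ext_iff, Fin.val_rev]
    omega
  by_cases hz : z.rev = z
  · exact HasInvariantLast.not_of_append hN hP hS hw hω _
      (.of_forall_eq fun i => (hrev i).elim id fun hi => hi.trans hz)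
  · have hh : P.h ≤ 1 := by
      simp only [Fin.ext_iff, Fin.val_rev] at hz
      omega
    exact HasInvariantLast.not_of_append hN hP hS hw hω _ (.of_headshunt_le_one hh hz hrev)

theorem spacious (hN : P.IsNatural) (hP : P.AlwaysSolvable) (hS : P.S.Nonempty)
    (hw : 2 ≤ Fintype.card W) : Spacious (Fintype.card W) P.h P.m where
  one_le := P.h_pos
  le_sum := hN.le_sum hP hS
  add_lt := hN.card_add_lt hP hS hw
  sidings := by
    have hcard : #{i | 0 < P.m i} = P.s := by
      rw [Finset.filter_true_of_mem fun i _ => P.m_pos i, Finset.card_fin]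
    exact hcard.symm ▸ hN.two_le_headshunt_or_three_le_sidings hP hS hw

theorem exists_walk (hN : P.IsNatural) (hP : P.AlwaysSolvable) {p : Position W P.h P.m}
    (hp : p ∈ P.S) :
    ∃ q ∈ P.F, ∃ γ : P.graph.Walk p q,
      γ.length + 10 ≤ 2 * Fintype.card W ^ 2 + 12 * Fintype.card W := by
  obtain ⟨q, hq, -⟩ := hP p hp
  exact ⟨q, hq, exists_walk_of_spacious P.h_pos P.wagons_pos (hN.le_sum hP ⟨p, hp⟩)
    (hN.spacious hP ⟨p, hp⟩) p q⟩

end Puzzle.IsNatural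

end Natural

section Inversions

variable {α : Type*}

section LT

variable [LT α] [DecidableLT α]

/-- The number of inversions of a list, i.e. of pairs of entries that are in the wrong order. -/
def inversions : List α → ℕ
  | [] => 0
  | a :: l => l.countP (· < a) + inversions l

theorem inversions_swap_le (X Y : List α) (a b : α) :
    inversions (X ++ a :: b :: Y) ≤ inversions (X ++ b :: a :: Y) + 1 := by
  induction X with
  | nil =>
    simp only [List.nil_append, inversions, List.countP_cons]
    split_ifs <;> omega
  | cons x X ih =>
    have hperm : (X ++ a :: b :: Y).Perm (X ++ b :: a :: Y) :=
      (List.Perm.swap b a Y).append_left X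
    simp only [List.cons_append, inversions, hperm.countP_eq]
    omega

theorem inversions_reverse_le (X Y : List α) {l : List α} (hl : l.length ≤ 2) :
    inversions (X ++ l ++ Y) ≤ inversions (X ++ l.reverse ++ Y) + 1 := by
  match l, hl with
  | [], _ => exact Nat.le_succ _
  | [_], _ => exact Nat.le_succ _
  | [a, b], _ => simpa using inversions_swap_le X Y a b

/-- The disorder of a line of wagons in which the stretch `l` may be read in either direction: the
total number of inversions of both readings. -/
def lineDisorder (X l Y : List α) : ℕ :=
  inversions (X ++ l ++ Y) + inversions (X ++ l.reverse ++ Y)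

theorem lineDisorder_reverse (X l Y : List α) :
    lineDisorder X l.reverse Y = lineDisorder X l Y := by
  rw [lineDisorder, lineDisorder, List.reverse_reverse, add_comm]

theorem lineDisorder_eq_two_mul (X Y : List α) {l : List α} (hl : l.length ≤ 1) :
    lineDisorder X l Y = 2 * inversions (X ++ l ++ Y) := by
  rw [lineDisorder, reverse_eq_self_of_length_le_one hl, two_mul]

theorem lineDisorder_le_of_append_eq {X Y X' Y' l l' : List α} (hl : l.length ≤ 2)
    (hl' : l'.length ≤ 2) (hne : l.length ≠ l'.length) (heq : X ++ l ++ Y = X' ++ l' ++ Y') :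
    lineDisorder X l Y ≤ lineDisorder X' l' Y' + 1 := by
  have hshort : l.length ≤ 1 ∨ l'.length ≤ 1 := by omega
  rcases hshort with hshort | hshort
  · have hrev := inversions_reverse_le X' Y' hl'
    rw [lineDisorder_eq_two_mul X Y hshort, heq, lineDisorder]
    omega
  · have hrev := inversions_reverse_le X Y (l.length_reverse.trans_le hl)
    rw [List.reverse_reverse] at hrev
    rw [lineDisorder_eq_two_mul X' Y' hshort, ← heq, lineDisorder]
    omega

end LT

variable [Preorder α] [DecidableLT α]

theorem inversions_eq_zero {l : List α} (hl : l.SortedLE) : inversions l = 0 := by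
  rw [List.sortedLE_iff_pairwise] at hl
  induction hl with
  | nil => rfl
  | cons ha _ ih =>
    simp only [inversions, ih, add_zero, List.countP_eq_zero, decide_eq_true_eq]
    exact fun x hx => (ha x hx).not_gt

theorem two_mul_inversions_add_length {l : List α} (hl : l.SortedGT) :
    2 * inversions l + l.length = l.length ^ 2 := by
  rw [List.sortedGT_iff_pairwise] at hl
  induction hl with
  | nil => rfl
  | @cons a l ha _ ih =>
    have hcount : l.countP (· < a) = l.length :=
      List.countP_eq_length.2 fun x hx => decide_eq_true (ha x hx)
    rw [inversions, hcount, List.length_cons]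
    linarith

end Inversions

section LowerBound

variable {W : Type*} {m : Fin 2 → ℕ}

/-- The disorder of a position in a puzzle with two sidings, whose wagons form a line from the
buffer stop of the first siding to that of the second, with the headshunt read in either
direction. -/
def Position.disorder [LT W] [DecidableLT W] {h : ℕ} (p : Position W h m) : ℕ :=
  lineDisorder (p.track 1).reverse (p.track 0) (p.track 2)

theorem Position.disorder_of_yard_eq [LT W] [DecidableLT W] {h : ℕ} {p : Position W h m}
    {l : List W} (hp : p.yard = ⟨[], ![[], l]⟩) : p.disorder = 2 * inversions l := by
  have htrack₀ : p.track 0 = [] := congrArg Yard.headshunt hp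
  have htrack₁ : p.track 1 = [] := congrFun (congrArg Yard.siding hp) 0
  have htrack₂ : p.track 2 = l := congrFun (congrArg Yard.siding hp) 1
  rw [disorder, htrack₀, htrack₁, htrack₂, lineDisorder_eq_two_mul _ _ zero_le_one]
  rfl

theorem IsMove.disorder_le [LT W] [DecidableLT W] {p q : Position W 2 m} (hpq : IsMove p q) :
    p.disorder ≤ q.disorder + 1 := by
  have hne := hpq.length_headshunt_ne
  obtain ⟨-, r, hr, happend⟩ := hpq
  obtain rfl | rfl : r = 0 ∨ r = 1 := by omega
  · have hsiding : p.track 2 = q.track 2 := hr 1 (by decide)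
    rw [Position.disorder, Position.disorder, ← lineDisorder_reverse,
      ← lineDisorder_reverse _ (q.track 0)]
    refine lineDisorder_le_of_append_eq (by simpa using p.headshunt_le)
      (by simpa using q.headshunt_le) (by simpa using hne) ?_
    rw [hsiding, ← List.reverse_append, ← List.reverse_append]
    exact congrArg (·.reverse ++ _) happend
  · have hsiding : p.track 1 = q.track 1 := hr 0 (by decide)
    refine lineDisorder_le_of_append_eq p.headshunt_le q.headshunt_le hne ?_
    rw [hsiding, List.append_assoc, List.append_assoc]
    exact congrArg (_ ++ ·) happend

theorem disorder_le_add_length [LT W] [DecidableLT W] {p q : Position W 2 m}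
    (γ : (graph W 2 m).Walk p q) : p.disorder ≤ q.disorder + γ.length := by
  induction γ with
  | nil => exact le_rfl
  | cons hadj _ ih =>
    have hmove := IsMove.disorder_le hadj
    rw [SimpleGraph.Walk.length_cons]
    omega

theorem length_sq_le_length_walk_add_length [Preorder W] {l : List W} (hl : l.SortedLT)
    {p q : Position W 2 m} (hp : p.yard = ⟨[], ![[], l.reverse]⟩)
    (hq : q.yard = ⟨[], ![[], l]⟩) (γ : (graph W 2 m).Walk p q) :
    l.length ^ 2 ≤ γ.length + l.length := by
  classical
  have hwalk := disorder_le_add_length γ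
  have hinversions := two_mul_inversions_add_length hl.reverse
  rw [Position.disorder_of_yard_eq hp, Position.disorder_of_yard_eq hq,
    inversions_eq_zero hl.sortedLE] at hwalk
  rw [List.length_reverse] at hinversions
  omega

variable [Fintype W]

theorem exists_position_yard_eq {h : ℕ} {l : List W} (hl : l.Nodup) (hmem : ∀ a, a ∈ l) :
    ∃ p : Position W h fun _ : Fin 2 => Fintype.card W, p.yard = ⟨[], ![[], l]⟩ := by
  have hcontents : (⟨[], ![[], l]⟩ : Yard W (Fin 2)).contents = l := by
    simp [Yard.contents]
  refine Position.exists_yard_eq ⟨Nat.zero_le _, Fin.forall_fin_two.2 ⟨Nat.zero_le _, ?_⟩⟩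
    (hcontents ▸ Multiset.coe_nodup.2 hl) (hcontents ▸ hmem)
  exact hl.length_le_card

/-- The puzzle in which the finishing position `q` has to be reached from an arbitrary position,
with a headshunt of length two and two sidings each of which has room for all wagons. -/
def sortingPuzzle (hw : 0 < Fintype.card W)
    (q : Position W 2 fun _ : Fin 2 => Fintype.card W) : Puzzle W where
  s := 2
  h := 2
  m := fun _ => Fintype.card W
  wagons_pos := hw
  s_pos := two_pos
  h_pos := two_pos
  m_pos := fun _ => hw
  wagons_lt := by
    rw [Fin.sum_univ_two]
    omega
  S := Set.univ
  F := {q}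

namespace sortingPuzzle

variable (hw : 0 < Fintype.card W) (q : Position W 2 fun _ : Fin 2 => Fintype.card W)

theorem isNatural (hq : q.track 2 ≠ []) : (sortingPuzzle hw q).IsNatural :=
  ⟨fun _ _ _ => Set.mem_univ _, (1 : Fin 2), (q.track 2).getLast hq,
    forall_eq.2 (List.getLast?_eq_some_getLast hq)⟩

theorem alwaysSolvable : (sortingPuzzle hw q).AlwaysSolvable := by
  have hsum : ∑ _ : Fin 2, Fintype.card W = Fintype.card W + Fintype.card W := Fin.sum_univ_two _
  have hspacious : Spacious (Fintype.card W) 2 fun _ : Fin 2 => Fintype.card W :=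
    { one_le := one_le_two
      le_sum := by omega
      add_lt := fun _ => by omega
      sidings := .inl ⟨le_rfl, by
        rw [Finset.filter_true_of_mem fun _ _ => hw, Finset.card_fin]⟩ }
  intro p _
  obtain ⟨γ, -⟩ := exists_walk_of_spacious one_le_two hw hspacious.le_sum (fun _ => hspacious) p q
  exact ⟨q, rfl, ⟨γ⟩⟩

end sortingPuzzle

theorem exists_isNatural_alwaysSolvable (W : Type*) [Fintype W] (hw : 0 < Fintype.card W) :
    ∃ P : Puzzle W, P.IsNatural ∧ P.AlwaysSolvable ∧ ∃ p ∈ P.S, ∀ q ∈ P.F,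
      ∀ γ : P.graph.Walk p q, Fintype.card W ^ 2 ≤ γ.length + Fintype.card W := by
  classical
  let : LinearOrder W := LinearOrder.lift' (Fintype.equivFin W) (Fintype.equivFin W).injective
  set l : List W := (univ : Finset W).sort
  have hmem (a : W) : a ∈ l := (Finset.mem_sort _).2 (mem_univ a)
  have hnodup : l.Nodup := Finset.sort_nodup _ _
  have hlen : l.length = Fintype.card W := Finset.length_sort _
  obtain ⟨p, hp⟩ := exists_position_yard_eq (h := 2) (List.nodup_reverse.2 hnodup)
    fun a => List.mem_reverse.2 (hmem a)
  obtain ⟨q, hq⟩ := exists_position_yard_eq (h := 2) hnodup hmem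
  have hq_ne_nil : q.track 2 ≠ [] := by
    have htrack : q.track 2 = l := congrFun (congrArg Yard.siding hq) 1
    rw [htrack, ← List.length_pos_iff, hlen]
    exact hw
  refine ⟨sortingPuzzle hw q, sortingPuzzle.isNatural hw q hq_ne_nil,
    sortingPuzzle.alwaysSolvable hw q, p, Set.mem_univ p, forall_eq.2 fun γ => ?_⟩
  exact hlen ▸ length_sq_le_length_walk_add_length (Finset.sortedLT_sort _) hp hq γ

end LowerBound

end Inglenook

theorem mainTheorem3 (w : ℕ) (hw : 1 ≤ w) (W : Type*) [Fintype W] (hW : Fintype.card W = w) :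
    (∀ P : Inglenook.Puzzle W, P.IsNatural → P.AlwaysSolvable →
      ∀ p ∈ P.S, ∃ q ∈ P.F, ∃ γ : P.graph.Walk p q,
        (γ.length : ℝ) ≤ 2 * (w : ℝ) ^ 2 + 12 * (w : ℝ) - 10) ∧
    (∃ P : Inglenook.Puzzle W, P.IsNatural ∧ P.AlwaysSolvable ∧
      ∃ p ∈ P.S, ∀ q ∈ P.F, ∀ γ : P.graph.Walk p q,
        ((w : ℝ) ^ 2 - 1) / 2 ≤ (γ.length : ℝ)) := by
  subst hW
  refine ⟨fun P hN hP p hp => ?_, ?_⟩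
  · obtain ⟨q, hq, γ, hγ⟩ := hN.exists_walk hP hp
    refine ⟨q, hq, γ, ?_⟩
    rw [le_sub_iff_add_le]
    exact_mod_cast hγ
  · obtain ⟨P, hN, hP, p, hp, hlower⟩ := Inglenook.exists_isNatural_alwaysSolvable W hw
    refine ⟨P, hN, hP, p, hp, fun q hq γ => ?_⟩
    have hγ : (Fintype.card W : ℝ) ^ 2 ≤ γ.length + Fintype.card W := by
      exact_mod_cast hlower q hq γ
    linarith [sq_nonneg ((Fintype.card W : ℝ) - 1)]
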